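/- Let $(\mathcal Z,d)$ be a locally compact, $\sigma$-compact Polish metric space, i.e. a metric space whose topology is locally compact, $\sigma$-compact and Polish (in particular, any complete separable metric space that is locally compact and $\sigma$-compact), and let $Q$ be a Borel probability measure on $\mathcal Z$. Write $C_b(\mathcal Z)$ for the bounded continuous real functions on $\mathcal Z$, $Q(f)=\int f\,dQ$, and $D(P\|Q)$ for the relative entropy (natural logarithm). For $p\in[1,\infty)$ and $\lambda\in(0,\infty)$, say that $Q$ satisfies ${\rm T}_p(\lambda)$ if for every Borel probability measure $P\ll Q$, $$\inf_{\pi}\left(\mathbb E[d(X,Y)^p]\right)^{1/p}\le\sqrt{2\lambda D(P\|Q)},$$ where the infimum is over all couplings $\pi$ of $P$ and $Q$ and $(X,Y)\sim\pi$; both sides may be $+\infty$. (a) $Q$ satisfies ${\rm T}_2(1)$ if and only if for every $f\in C_b(\mathcal Z)$, $$\log Q\left(\exp\left(\inf_{z\in\mathcal Z}\left[f(z)+\frac{d^2(\cdot,z)}{2}\right]\right)\right)\le Q(f).$$ (b) For every $p\in[1,2)$, $Q$ satisfies ${\rm T}_p(1)$ if and only if for all $t\in[0,\infty)$ and all $f\in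 C_b(\mathcal Z)$, $$\log Q\left(\exp\left(t\inf_{z\in\mathcal Z}\left[f(z)+\frac{d^p(\cdot,z)}{p}\right]\right)\right)\le\left(\frac1p-\frac12\right)t^{\frac{2}{2-p}}+t\,Q(f).$$ -/

import Mathlib

open MeasureTheory
open scoped ENNReal NNReal BoundedContinuousFunction

/-- `π` is a coupling of `P` and `Q`: a Borel measure on the product whose first marginal is `P`
and whose second marginal is `Q`. -/
structure IsCoupling {Z : Type*} [MeasurableSpace Z]
    (π : Measure (Z × Z)) (P Q : Measure Z) : Prop where
  map_fst : π.map Prod.fst = P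
  map_snd : π.map Prod.snd = Q

/-- The transportation cost `inf_π (E[d(X, Y) ^ p]) ^ (1 / p)`, with `(X, Y) ∼ π` and `π` ranging
over all couplings of `P` and `Q`, as an element of `[0, ∞]`. -/
noncomputable def transportCost {Z : Type*} [MetricSpace Z] [MeasurableSpace Z]
    (p : ℝ) (P Q : Measure Z) : ℝ≥0∞ :=
  ⨅ (π : Measure (Z × Z)) (_ : IsCoupling π P Q), (∫⁻ w, edist w.1 w.2 ^ p ∂π) ^ (1 / p)

/-- The transportation-cost inequality `T_p(lam)`: for every probability measure `P ≪ Q`,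
`inf_π (E[d(X, Y) ^ p]) ^ (1 / p) ≤ √(2 * lam * D(P‖Q))`, an inequality in `[0, ∞]`, where
`D(P‖Q)` is the relative entropy (natural logarithm). -/
def SatisfiesT {Z : Type*} [MetricSpace Z] [MeasurableSpace Z]
    (p : ℝ) (lam : ℝ≥0) (Q : Measure Z) : Prop :=
  ∀ P : Measure Z, IsProbabilityMeasure P → P ≪ Q →
    transportCost p P Q ≤ (2 * (lam : ℝ≥0∞) * InformationTheory.klDiv P Q) ^ (1 / 2 : ℝ)

/-! Write f^c for the transform of f with cost c = d^p/p, and D = D(P‖Q). Kantorovich duality turns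
`T_p(1)` into P(f^c) ≤ Q(f) + (2D)^(p/2)/p for all bounded continuous f and all P ≪ Q with D finite.
By the Gibbs variational principle, log Q(exp g) is the supremum over such P of P(g) - D, attained
at the tilted measure. For p = 2 the error term is D itself, so g = f^c gives (a). For p < 2 the
error is concave in D: Young's inequality bounds it by an affine function of D for each t, with
equality at some t when D > 0, and g = t f^c gives (b).

Only the hard half of duality needs topology. A dual bound is positivity of a functional on a cone;
M. Riesz extension carries it to bounded continuous functions on the product, and tightness of the
marginals makes the extension a measure, the desired coupling. -/

open Filter Topology CompactlySupported

/-! ### Compactly supported cutoffs -/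

section Cutoffs

/-- A locally compact, `σ`-compact regular space has a sequence of compactly supported cutoff
functions that are pointwise eventually equal to one. -/
theorem exists_cutoff_sequence (X : Type*) [TopologicalSpace X] [RegularSpace X]
    [LocallyCompactSpace X] [SigmaCompactSpace X] :
    ∃ χ : ℕ → C(X, ℝ), (∀ n, HasCompactSupport (χ n)) ∧ (∀ n x, χ n x ∈ Set.Icc (0 : ℝ) 1) ∧
      ∀ x, ∀ᶠ n in atTop, χ n x = 1 := by
  let K : CompactExhaustion X := default
  have key : ∀ n, ∃ f : C(X, ℝ), Set.EqOn f 1 (K n) ∧ HasCompactSupport f ∧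
      ∀ x, f x ∈ Set.Icc (0 : ℝ) 1 := fun n ↦ by
    obtain ⟨f, h1, -, h2, h3⟩ := exists_continuous_one_zero_of_isCompact (K.isCompact n)
      isClosed_empty (Set.disjoint_empty _)
    exact ⟨f, h1, h2, h3⟩
  choose χ h1 h2 h3 using key
  refine ⟨χ, h2, h3, fun x ↦ ?_⟩
  obtain ⟨m, hm⟩ := K.exists_mem x
  filter_upwards [eventually_ge_atTop m] with n hn
  exact h1 n (K.subset hn hm)

end Cutoffs

/-! ### From tight positive functionals to measures -/

section RieszMarkov

variable {X : Type*} [TopologicalSpace X] [T2Space X] [LocallyCompactSpace X]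
  [MeasurableSpace X] [BorelSpace X]

/-- A positive linear functional on bounded continuous functions that is tight along a sequence of
compactly supported cutoffs is integration against a finite measure. -/
theorem exists_isFiniteMeasure_of_tight_functional (L : (X →ᵇ ℝ) →ₗ[ℝ] ℝ)
    (hL : ∀ u : X →ᵇ ℝ, 0 ≤ u → 0 ≤ L u) (χ : ℕ → C_c(X, ℝ))
    (hχ : ∀ n x, χ n x ∈ Set.Icc (0 : ℝ) 1) (hχ1 : ∀ x, Tendsto (fun n ↦ χ n x) atTop (𝓝 1))
    (htight : Tendsto (fun n ↦ L (1 - (χ n).toBoundedContinuousFunction)) atTop (𝓝 0)) :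
    ∃ π : Measure X, IsFiniteMeasure π ∧ ∀ u : X →ᵇ ℝ, ∫ x, u x ∂π = L u := by
  have hmono : ∀ u v : X →ᵇ ℝ, u ≤ v → L u ≤ L v := fun u v h ↦ by
    have := hL (v - u) (sub_nonneg.2 h)
    rw [map_sub] at this
    linarith
  let J : C_c(X, ℝ) →ₗ[ℝ] (X →ᵇ ℝ) :=
    { toFun := fun f ↦ f.toBoundedContinuousFunction
      map_add' := fun f g ↦ by ext; rfl
      map_smul' := fun r f ↦ by ext; rfl }
  let Λ : C_c(X, ℝ) →ₚ[ℝ] ℝ := PositiveLinearMap.mk₀ (L ∘ₗ J) fun f hf ↦ hL _ fun x ↦ hf x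
  have hΛ : ∀ f : C_c(X, ℝ), ∫ x, f x ∂(RealRMK.rieszMeasure Λ) = L (J f) := fun f ↦
    RealRMK.integral_rieszMeasure Λ f
  set π := RealRMK.rieszMeasure Λ
  have hχint : ∀ n, Integrable (χ n) π := fun n ↦
    (χ n).continuous.integrable_of_hasCompactSupport (χ n).hasCompactSupport
  have hfin : IsFiniteMeasure π := by
    have hbound : π Set.univ ≤ ENNReal.ofReal (L 1) := by
      calc π Set.univ = ∫⁻ _, 1 ∂π := by simp
        _ = ∫⁻ x, liminf (fun n ↦ ENNReal.ofReal (χ n x)) atTop ∂π := by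
          refine lintegral_congr fun x ↦ ?_
          have := (ENNReal.continuous_ofReal.tendsto 1).comp (hχ1 x)
          rw [ENNReal.ofReal_one] at this
          exact this.liminf_eq.symm
        _ ≤ liminf (fun n ↦ ∫⁻ x, ENNReal.ofReal (χ n x) ∂π) atTop :=
          lintegral_liminf_le fun n ↦ (χ n).continuous.measurable.ennreal_ofReal
        _ ≤ liminf (fun _ : ℕ ↦ ENNReal.ofReal (L 1)) atTop := by
          refine liminf_le_liminf (Eventually.of_forall fun n ↦ ?_)
          rw [← ofReal_integral_eq_lintegral_ofReal (hχint n)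
            (Eventually.of_forall fun x ↦ (hχ n x).1), hΛ]
          exact ENNReal.ofReal_le_ofReal (hmono _ _ fun x ↦ (hχ n x).2)
        _ = ENNReal.ofReal (L 1) := liminf_const _
    exact ⟨hbound.trans_lt ENNReal.ofReal_lt_top⟩
  refine ⟨π, hfin, fun u ↦ ?_⟩
  let v : ℕ → C_c(X, ℝ) := fun n ↦
    ⟨⟨fun x ↦ u x * χ n x, u.continuous.mul (χ n).continuous⟩,
      (χ n).hasCompactSupport.mul_left⟩
  have hv : ∀ n x, v n x = u x * χ n x := fun n x ↦ rfl
  have h1 : Tendsto (fun n ↦ ∫ x, v n x ∂π) atTop (𝓝 (∫ x, u x ∂π)) := by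
    refine tendsto_integral_of_dominated_convergence (fun _ ↦ ‖u‖)
      (fun n ↦ (v n).continuous.aestronglyMeasurable) (integrable_const _)
      (fun n ↦ Eventually.of_forall fun x ↦ ?_) (Eventually.of_forall fun x ↦ ?_)
    · rw [hv, norm_mul]
      have h2 : ‖χ n x‖ ≤ 1 := by
        rw [Real.norm_of_nonneg (hχ n x).1]; exact (hχ n x).2
      calc ‖u x‖ * ‖χ n x‖ ≤ ‖u‖ * 1 := by
            gcongr
            exact u.norm_coe_le_norm x
        _ = ‖u‖ := mul_one _
    · simpa [hv] using (hχ1 x).const_mul (u x)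
  have h2 : Tendsto (fun n ↦ L (J (v n))) atTop (𝓝 (L u)) := by
    rw [tendsto_iff_norm_sub_tendsto_zero]
    -- Since |uχₙ - u| ≤ ‖u‖(1 - χₙ), positivity and tightness control the error of truncation.
    have h3 : Tendsto (fun n ↦ ‖u‖ * L (1 - J (χ n))) atTop (𝓝 0) := by
      have := htight.const_mul ‖u‖
      rwa [mul_zero] at this
    refine squeeze_zero (fun _ ↦ norm_nonneg _) (fun n ↦ ?_) h3
    have hb : ∀ x, |u x| ≤ ‖u‖ := u.norm_coe_le_norm
    rw [← map_sub, Real.norm_eq_abs, ← smul_eq_mul, ← map_smul, abs_le, ← map_neg]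
    constructor
    · refine hmono _ _ fun x ↦ ?_
      have := abs_le.1 (hb x)
      have hx := hχ n x
      change -(‖u‖ * (1 - χ n x)) ≤ u x * χ n x - u x
      nlinarith [hx.1, hx.2]
    · refine hmono _ _ fun x ↦ ?_
      have := abs_le.1 (hb x)
      have hx := hχ n x
      change u x * χ n x - u x ≤ ‖u‖ * (1 - χ n x)
      nlinarith [hx.1, hx.2]
  refine tendsto_nhds_unique h1 ?_
  simpa only [hΛ] using h2

end RieszMarkov

/-! ### The cost transform of a bounded continuous function -/

section InfConvolution

/-- The `c`-transform `x ↦ inf_z (f z + c x z)`. -/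
noncomputable def costTransform {Z : Type*} (c : Z → Z → ℝ) (f : Z → ℝ) (x : Z) : ℝ :=
  ⨅ z, (f z + c x z)

variable {Z : Type*} [TopologicalSpace Z] {c : Z → Z → ℝ}

theorem bddBelow_range_add_cost (hc0 : ∀ x y, 0 ≤ c x y) (f : Z →ᵇ ℝ) (x : Z) :
    BddBelow (Set.range fun z ↦ f z + c x z) := by
  refine ⟨-‖f‖, ?_⟩
  rintro _ ⟨z, rfl⟩
  have := f.neg_norm_le_apply z
  have := hc0 x z
  dsimp only
  linarith

theorem costTransform_le (hc0 : ∀ x y, 0 ≤ c x y) (f : Z →ᵇ ℝ) (x z : Z) :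
    costTransform c f x ≤ f z + c x z :=
  ciInf_le (bddBelow_range_add_cost hc0 f x) z

theorem abs_costTransform_le (hc0 : ∀ x y, 0 ≤ c x y) (hcd : ∀ x, c x x = 0) (f : Z →ᵇ ℝ)
    (x : Z) : |costTransform c f x| ≤ ‖f‖ := by
  have : Nonempty Z := ⟨x⟩
  rw [abs_le]
  constructor
  · refine le_ciInf fun z ↦ ?_
    have := f.neg_norm_le_apply z
    have := hc0 x z
    linarith
  · refine (costTransform_le hc0 f x x).trans ?_
    rw [hcd, add_zero]
    exact f.apply_le_norm x

/-- An infimum of continuous functions is upper semicontinuous, even over an uncountable family. -/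
theorem measurable_costTransform [MeasurableSpace Z] [OpensMeasurableSpace Z]
    (hc : Continuous fun w : Z × Z ↦ c w.1 w.2) (hc0 : ∀ x y, 0 ≤ c x y) (f : Z →ᵇ ℝ) :
    Measurable (costTransform c f) := by
  refine UpperSemicontinuous.measurable ?_
  refine upperSemicontinuous_ciInf (fun x ↦ bddBelow_range_add_cost hc0 f x) fun z ↦ ?_
  refine Continuous.upperSemicontinuous ?_
  exact continuous_const.add (hc.comp (continuous_id.prodMk continuous_const))

theorem integrable_costTransform [MeasurableSpace Z] [OpensMeasurableSpace Z]
    (hc : Continuous fun w : Z × Z ↦ c w.1 w.2) (hc0 : ∀ x y, 0 ≤ c x y) (hcd : ∀ x, c x x = 0)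
    (f : Z →ᵇ ℝ) (P : Measure Z) [IsFiniteMeasure P] : Integrable (costTransform c f) P :=
  Integrable.of_bound (measurable_costTransform hc hc0 f).aestronglyMeasurable ‖f‖
    (Eventually.of_forall fun x ↦ abs_costTransform_le hc0 hcd f x)

end InfConvolution

/-! ### Kantorovich duality by extension of positive functionals -/

section Kantorovich

variable {Z : Type*} [TopologicalSpace Z] [MeasurableSpace Z] [OpensMeasurableSpace Z]
  {c : Z → Z → ℝ}

/-- A dual bound on the transport problem with marginals `P` and `Q` produces a positive functional
with these marginals whose cost satisfies the same bound. -/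
theorem exists_positive_functional_of_dual_bound (hc : Continuous fun w : Z × Z ↦ c w.1 w.2)
    (hc0 : ∀ x y, 0 ≤ c x y) (hcd : ∀ x, c x x = 0) (P Q : Measure Z) [IsProbabilityMeasure P]
    [IsProbabilityMeasure Q] {A : ℝ}
    (hA : ∀ f : Z →ᵇ ℝ, ∫ x, costTransform c f x ∂P ≤ ∫ x, f x ∂Q + A) :
    ∃ L : (Z × Z →ᵇ ℝ) →ₗ[ℝ] ℝ, (∀ u : Z × Z →ᵇ ℝ, 0 ≤ u → 0 ≤ L u) ∧
      (∀ φ : Z →ᵇ ℝ, L (φ.compContinuous ContinuousMap.fst) = ∫ x, φ x ∂P) ∧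
      (∀ φ : Z →ᵇ ℝ, L (φ.compContinuous ContinuousMap.snd) = ∫ x, φ x ∂Q) ∧
      ∀ u : Z × Z →ᵇ ℝ, (∀ w, u w ≤ c w.1 w.2) → L u ≤ A := by
  obtain ⟨z₀⟩ : Nonempty Z := nonempty_of_isProbabilityMeasure P
  -- The real coordinate adjoins multiples of the cost, which may be unbounded; `F` gives the cost
  -- itself the value `A`.
  let E := (Z →ᵇ ℝ) × (Z →ᵇ ℝ) × ℝ × (Z × Z →ᵇ ℝ)
  let cone : PointedCone ℝ E :=
    { carrier := {e | 0 ≤ e.2.2.1 ∧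
        ∀ x y, 0 ≤ e.1 x + e.2.1 y + e.2.2.1 * c x y + e.2.2.2 (x, y)}
      zero_mem' := by simp
      add_mem' := by
        rintro ⟨φ, ψ, s, u⟩ ⟨φ', ψ', s', u'⟩ ⟨h1, h2⟩ ⟨h1', h2'⟩
        refine ⟨add_nonneg h1 h1', fun x y ↦ ?_⟩
        have := add_nonneg (h2 x y) (h2' x y)
        change 0 ≤ (φ x + φ' x) + (ψ y + ψ' y) + (s + s') * c x y + (u (x, y) + u' (x, y))
        dsimp only at this
        linarith
      smul_mem' := by
        rintro ⟨r, hr⟩ ⟨φ, ψ, s, u⟩ ⟨h1, h2⟩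
        refine ⟨mul_nonneg hr h1, fun x y ↦ ?_⟩
        have := mul_nonneg hr (h2 x y)
        change 0 ≤ r * φ x + r * ψ y + (r * s) * c x y + r * u (x, y)
        dsimp only at this
        linarith }
  have hcone : ∀ φ ψ s u, ((φ, ψ, s, u) : E) ∈ cone ↔
      0 ≤ s ∧ ∀ x y, 0 ≤ φ x + ψ y + s * c x y + u (x, y) := fun _ _ _ _ ↦ Iff.rfl
  let F : E →ₗ[ℝ] ℝ :=
    { toFun := fun e ↦ ∫ x, e.1 x ∂P + ∫ x, e.2.1 x ∂Q + e.2.2.1 * A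
      map_add' := by
        rintro ⟨φ, ψ, s, u⟩ ⟨φ', ψ', s', u'⟩
        change ∫ x, φ x + φ' x ∂P + ∫ x, ψ x + ψ' x ∂Q + (s + s') * A = _
        rw [integral_add (φ.integrable P) (φ'.integrable P),
          integral_add (ψ.integrable Q) (ψ'.integrable Q)]
        ring
      map_smul' := by
        rintro r ⟨φ, ψ, s, u⟩
        change ∫ x, r * φ x ∂P + ∫ x, r * ψ x ∂Q + (r * s) * A =
          r * (∫ x, φ x ∂P + ∫ x, ψ x ∂Q + s * A)
        rw [integral_const_mul, integral_const_mul]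
        ring }
  have hF : ∀ φ ψ s u, F (φ, ψ, s, u) = ∫ x, φ x ∂P + ∫ x, ψ x ∂Q + s * A := fun _ _ _ _ ↦ rfl
  let D : Submodule ℝ E :=
    LinearMap.ker (LinearMap.snd ℝ ℝ (Z × Z →ᵇ ℝ) ∘ₗ LinearMap.snd ℝ (Z →ᵇ ℝ) _ ∘ₗ
      LinearMap.snd ℝ (Z →ᵇ ℝ) _)
  have hD : ∀ φ ψ s, ((φ, ψ, s, 0) : E) ∈ D := fun _ _ _ ↦ rfl
  obtain ⟨g, hgF, hg⟩ := riesz_extension cone ⟨D, F ∘ₗ D.subtype⟩ (by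
      rintro ⟨⟨φ, ψ, s, u⟩, hu⟩ hmem
      obtain rfl : u = 0 := hu
      obtain ⟨hs, hnn⟩ := (hcone _ _ _ _).1 hmem
      change 0 ≤ F (φ, ψ, s, 0)
      rw [hF]
      -- For s = 0, integrate -φ(x) ≤ ψ(y) in each variable. For s > 0, dividing by s gives -φ/s ≤
      -- (ψ/s)^c, and `hA` applies.
      rcases hs.eq_or_lt with rfl | hs
      · have h1 : ∀ x y, -φ x ≤ ψ y := fun x y ↦ by
          have := hnn x y
          simp at this
          linarith
        have h2 : ∀ y, -∫ x, φ x ∂P ≤ ψ y := fun y ↦ by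
          rw [← integral_neg]
          calc ∫ x, -φ x ∂P ≤ ∫ _, ψ y ∂P :=
                integral_mono (φ.integrable P).neg (integrable_const _) fun x ↦ h1 x y
            _ = ψ y := by simp
        have h3 : -∫ x, φ x ∂P ≤ ∫ y, ψ y ∂Q := by
          calc -∫ x, φ x ∂P = ∫ _, -∫ x, φ x ∂P ∂Q := by simp
            _ ≤ ∫ y, ψ y ∂Q := integral_mono (integrable_const _) (ψ.integrable Q) h2
        linarith
      · have h1 : ∫ x, -(s⁻¹ * φ x) ∂P ≤ ∫ x, costTransform c (s⁻¹ • ψ) x ∂P := by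
          refine integral_mono ((φ.integrable P).const_mul _).neg
            (integrable_costTransform hc hc0 hcd (s⁻¹ • ψ) P) fun x ↦ ?_
          have : Nonempty Z := ⟨z₀⟩
          refine le_ciInf fun z ↦ ?_
          have h2 := mul_nonneg (inv_nonneg.2 hs.le) (hnn x z)
          have h3 : s⁻¹ * (φ x + ψ z + s * c x z) = s⁻¹ * φ x + s⁻¹ * ψ z + c x z := by
            field_simp
          simp only [BoundedContinuousFunction.coe_zero, Pi.zero_apply, add_zero, h3] at h2
          change -(s⁻¹ * φ x) ≤ s⁻¹ * ψ z + c x z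
          linarith
        have h2 := h1.trans (hA (s⁻¹ • ψ))
        simp only [BoundedContinuousFunction.coe_smul, smul_eq_mul, integral_neg,
          integral_const_mul] at h2
        have h3 := mul_le_mul_of_nonneg_left h2 hs.le
        have h4 : s * (-(s⁻¹ * ∫ x, φ x ∂P)) = -∫ x, φ x ∂P := by field_simp
        have h5 : s * (s⁻¹ * ∫ x, ψ x ∂Q + A) = ∫ x, ψ x ∂Q + s * A := by field_simp
        linarith)
    (by
      rintro ⟨φ, ψ, s, u⟩
      -- Norms absorb the bounded parts, and -s cancels the cost term.
      refine ⟨⟨(BoundedContinuousFunction.const Z ‖φ‖,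
        BoundedContinuousFunction.const Z (‖ψ‖ + ‖u‖), -s, 0), hD _ _ _⟩, ?_⟩
      refine (hcone _ _ _ _).2 ⟨by simp, fun x y ↦ ?_⟩
      have h1 := φ.neg_norm_le_apply x
      have h2 := ψ.neg_norm_le_apply y
      have h3 := u.neg_norm_le_apply (x, y)
      simp
      linarith)
  have hgval : ∀ φ ψ s, g (φ, ψ, s, 0) = ∫ x, φ x ∂P + ∫ x, ψ x ∂Q + s * A := fun φ ψ s ↦
    hgF ⟨_, hD φ ψ s⟩
  let ι : (Z × Z →ᵇ ℝ) →ₗ[ℝ] E := LinearMap.inr ℝ (Z →ᵇ ℝ) _ ∘ₗ LinearMap.inr ℝ (Z →ᵇ ℝ) _ ∘ₗ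
    LinearMap.inr ℝ ℝ _
  have hι : ∀ u, ι u = (0, 0, 0, u) := fun _ ↦ rfl
  have hsplit : ∀ φ ψ s u, g (φ, ψ, s, -u) = ∫ x, φ x ∂P + ∫ x, ψ x ∂Q + s * A - g (ι u) := by
    intro φ ψ s u
    rw [← hgval, ← map_sub, hι]
    congr 1
    change _ = (φ - 0, ψ - 0, s - 0, 0 - u)
    simp only [sub_zero, zero_sub]
  have hle : ∀ (φ ψ : Z →ᵇ ℝ) (s : ℝ) (u : Z × Z →ᵇ ℝ), 0 ≤ s → (∀ x y, u (x, y) ≤ φ x + ψ y + s * c x y) →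
      g (ι u) ≤ ∫ x, φ x ∂P + ∫ x, ψ x ∂Q + s * A := by
    intro φ ψ s u hs h
    have := hg (φ, ψ, s, -u) ((hcone _ _ _ _).2 ⟨hs, fun x y ↦ by
      have := h x y
      simp
      linarith⟩)
    rw [hsplit] at this
    linarith
  have hmarg : ∀ (φ ψ : Z →ᵇ ℝ) (u : Z × Z →ᵇ ℝ), (∀ x y, u (x, y) = φ x + ψ y) →
      g (ι u) = ∫ x, φ x ∂P + ∫ x, ψ x ∂Q := by
    intro φ ψ u h
    -- With s = 0 the upper bound holds for u and for -u, hence equality.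
    refine le_antisymm ?_ ?_
    · simpa using hle φ ψ 0 u le_rfl fun x y ↦ by simp [h]
    · have := hle (-φ) (-ψ) 0 (-u) le_rfl fun x y ↦ by simp [h, add_comm]
      rw [show g (ι (-u)) = -g (ι u) from map_neg (g ∘ₗ ι) u] at this
      simp only [BoundedContinuousFunction.coe_neg, Pi.neg_apply, integral_neg] at this
      linarith
  refine ⟨g ∘ₗ ι, fun u hu ↦ ?_, fun φ ↦ ?_, fun φ ↦ ?_, fun u hu ↦ ?_⟩
  · exact hg _ ((hcone _ _ _ _).2 ⟨le_rfl, fun x y ↦ by simpa using hu (x, y)⟩)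
  · simpa using hmarg φ 0 (φ.compContinuous ContinuousMap.fst) fun x y ↦ by simp
  · simpa using hmarg 0 φ (φ.compContinuous ContinuousMap.snd) fun x y ↦ by simp
  · simpa using hle 0 0 1 u zero_le_one fun x y ↦ by simpa using hu (x, y)

end Kantorovich

/-! ### Weak and strong duality for couplings -/

section Coupling

variable {Z : Type*} [MeasurableSpace Z] {P Q : Measure Z} {π : Measure (Z × Z)}

theorem IsCoupling.isProbabilityMeasure [IsProbabilityMeasure P] (h : IsCoupling π P Q) :
    IsProbabilityMeasure π := by
  have : IsProbabilityMeasure (π.map Prod.fst) := by rw [h.map_fst]; infer_instance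
  exact Measure.isProbabilityMeasure_of_map Prod.fst

variable [TopologicalSpace Z] {c : Z → Z → ℝ}

/-- Weak Kantorovich duality. -/
theorem IsCoupling.ofReal_integral_costTransform_sub_le [OpensMeasurableSpace Z]
    [IsProbabilityMeasure P] [IsProbabilityMeasure Q] (h : IsCoupling π P Q)
    (hc : Continuous fun w : Z × Z ↦ c w.1 w.2) (hc0 : ∀ x y, 0 ≤ c x y) (hcd : ∀ x, c x x = 0)
    (f : Z →ᵇ ℝ) :
    ENNReal.ofReal (∫ x, costTransform c f x ∂P - ∫ x, f x ∂Q) ≤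
      ∫⁻ w, ENNReal.ofReal (c w.1 w.2) ∂π := by
  have := h.isProbabilityMeasure
  have hg := measurable_costTransform hc hc0 f
  have hgi := integrable_costTransform hc hc0 hcd f P
  have hgf : Integrable (fun w : Z × Z ↦ costTransform c f w.1) π := by
    rw [← h.map_fst] at hgi
    exact hgi.comp_measurable measurable_fst
  have hff : Integrable (fun w : Z × Z ↦ f w.2) π := by
    have hfi := f.integrable Q
    rw [← h.map_snd] at hfi
    exact hfi.comp_measurable measurable_snd
  have h1 : ∫ x, costTransform c f x ∂P = ∫ w, costTransform c f w.1 ∂π := by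
    rw [← h.map_fst, integral_map measurable_fst.aemeasurable hg.aestronglyMeasurable]
  have h2 : ∫ x, f x ∂Q = ∫ w, f w.2 ∂π := by
    rw [← h.map_snd, integral_map measurable_snd.aemeasurable
      f.continuous.measurable.aestronglyMeasurable]
  rw [h1, h2, ← integral_sub hgf hff]
  -- The cost may have infinite integral, so the comparison is made in [0, ∞] through the positive
  -- part.
  refine (ENNReal.ofReal_le_ofReal (integral_mono (hgf.sub hff) (hgf.sub hff).pos_part
    fun w ↦ le_max_left _ 0)).trans ?_
  rw [ofReal_integral_eq_lintegral_ofReal (hgf.sub hff).pos_part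
    (Eventually.of_forall fun w ↦ le_max_right _ _)]
  refine lintegral_mono fun w ↦ ENNReal.ofReal_le_ofReal (max_le ?_ (hc0 _ _))
  have := costTransform_le hc0 f w.1 w.2
  simp only [Pi.sub_apply]
  linarith

/-- Strong Kantorovich duality, with attainment of the primal problem. -/
theorem exists_isCoupling_of_dual_bound [T2Space Z] [LocallyCompactSpace Z] [SigmaCompactSpace Z]
    [SecondCountableTopology Z] [HasOuterApproxClosed Z] [BorelSpace Z] (P Q : Measure Z)
    [IsProbabilityMeasure P] [IsProbabilityMeasure Q]
    (hc : Continuous fun w : Z × Z ↦ c w.1 w.2) (hc0 : ∀ x y, 0 ≤ c x y) (hcd : ∀ x, c x x = 0)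
    {A : ℝ} (hA : ∀ f : Z →ᵇ ℝ, ∫ x, costTransform c f x ∂P ≤ ∫ x, f x ∂Q + A) :
    ∃ π, IsCoupling π P Q ∧ ∫⁻ w, ENNReal.ofReal (c w.1 w.2) ∂π ≤ ENNReal.ofReal A := by
  obtain ⟨L, hL, hL1, hL2, hLc⟩ :=
    exists_positive_functional_of_dual_bound hc hc0 hcd P Q hA
  obtain ⟨χ, hχc, hχ, hχ1⟩ := exists_cutoff_sequence Z
  let χ' : ℕ → Z →ᵇ ℝ := fun n ↦
    BoundedContinuousFunction.ofNormedAddCommGroup (χ n) (χ n).continuous 1 fun x ↦ by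
      rw [Real.norm_of_nonneg (hχ n x).1]; exact (hχ n x).2
  let η : ℕ → C_c(Z × Z, ℝ) := fun n ↦
    ⟨⟨fun w ↦ χ n w.1 * χ n w.2, by fun_prop⟩, by
      refine HasCompactSupport.intro ((hχc n).isCompact.prod (hχc n).isCompact) fun w hw ↦ ?_
      rw [Set.mem_prod, not_and_or] at hw
      rcases hw with hw | hw <;> simp [image_eq_zero_of_notMem_tsupport hw]⟩
  have hη : ∀ n w, η n w = χ n w.1 * χ n w.2 := fun _ _ ↦ rfl
  have hη01 : ∀ n w, η n w ∈ Set.Icc (0 : ℝ) 1 := fun n w ↦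
    ⟨mul_nonneg (hχ n _).1 (hχ n _).1, mul_le_one₀ (hχ n _).2 (hχ n _).1 (hχ n _).2⟩
  have htend : ∀ μ : Measure Z, IsProbabilityMeasure μ →
      Tendsto (fun n ↦ ∫ x, (1 - χ' n) x ∂μ) atTop (𝓝 0) := by
    intro μ _
    have h0 : (0 : ℝ) = ∫ _, (0 : ℝ) ∂μ := by simp
    rw [h0]
    refine tendsto_integral_of_dominated_convergence (fun _ ↦ 1)
      (fun n ↦ (1 - χ' n).continuous.aestronglyMeasurable) (integrable_const _)
      (fun n ↦ Eventually.of_forall fun x ↦ ?_) (Eventually.of_forall fun x ↦ ?_)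
    · change |1 - χ n x| ≤ 1
      have := hχ n x
      rw [abs_le]
      constructor <;> linarith [this.1, this.2]
    · refine tendsto_const_nhds.congr' ?_
      filter_upwards [hχ1 x] with n hn
      change 0 = 1 - χ n x
      rw [hn, sub_self]
  obtain ⟨π, hπ, hπL⟩ := exists_isFiniteMeasure_of_tight_functional L hL η hη01
    (fun w ↦ tendsto_const_nhds.congr' (by
      filter_upwards [hχ1 w.1, hχ1 w.2] with n h1 h2
      rw [hη, h1, h2, mul_one])) (by
    -- Tightness comes from the marginals: 1 - ab ≤ (1 - a) + (1 - b) for a, b in [0, 1].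
    have h0 := (htend P inferInstance).add (htend Q inferInstance)
    rw [add_zero] at h0
    refine squeeze_zero (fun n ↦ hL _ fun w ↦ sub_nonneg.2 (hη01 n w).2) (fun n ↦ ?_) h0
    rw [← hL1, ← hL2, ← map_add, ← sub_nonneg, ← map_sub]
    refine hL _ fun w ↦ ?_
    change 0 ≤ (1 - χ n w.1) + (1 - χ n w.2) - (1 - χ n w.1 * χ n w.2)
    nlinarith [(hχ n w.1).2, (hχ n w.2).2])
  refine ⟨π, ⟨?_, ?_⟩, ?_⟩
  · refine ext_of_forall_integral_eq_of_IsFiniteMeasure fun φ ↦ ?_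
    rw [integral_map measurable_fst.aemeasurable φ.continuous.measurable.aestronglyMeasurable,
      ← hL1, ← hπL]
    rfl
  · refine ext_of_forall_integral_eq_of_IsFiniteMeasure fun φ ↦ ?_
    rw [integral_map measurable_snd.aemeasurable φ.continuous.measurable.aestronglyMeasurable,
      ← hL2, ← hπL]
    rfl
  -- `L` sees only bounded functions, so the cost is truncated at n and recovered by Fatou.
  · let u : ℕ → Z × Z →ᵇ ℝ := fun n ↦
      BoundedContinuousFunction.ofNormedAddCommGroup (fun w ↦ min (c w.1 w.2) n)
        (hc.min continuous_const) n fun w ↦ by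
          rw [Real.norm_of_nonneg (le_min (hc0 _ _) n.cast_nonneg)]; exact min_le_right _ _
    have hu : ∀ n w, u n w = min (c w.1 w.2) n := fun _ _ ↦ rfl
    calc ∫⁻ w, ENNReal.ofReal (c w.1 w.2) ∂π
        = ∫⁻ w, liminf (fun n ↦ ENNReal.ofReal (u n w)) atTop ∂π := by
          refine lintegral_congr fun w ↦ (Tendsto.liminf_eq ?_).symm
          refine tendsto_const_nhds.congr' ?_
          obtain ⟨m, hm⟩ := exists_nat_ge (c w.1 w.2)
          filter_upwards [eventually_ge_atTop m] with n hn
          rw [hu, min_eq_left (hm.trans (by exact_mod_cast hn))]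
      _ ≤ liminf (fun n ↦ ∫⁻ w, ENNReal.ofReal (u n w) ∂π) atTop :=
          lintegral_liminf_le fun n ↦ (u n).continuous.measurable.ennreal_ofReal
      _ ≤ liminf (fun _ : ℕ ↦ ENNReal.ofReal A) atTop := by
          refine liminf_le_liminf (Eventually.of_forall fun n ↦ ?_)
          rw [← ofReal_integral_eq_lintegral_ofReal ((u n).integrable π)
            (Eventually.of_forall fun w ↦ le_min (hc0 _ _) n.cast_nonneg), hπL]
          exact ENNReal.ofReal_le_ofReal (hLc _ fun w ↦ min_le_left _ _)
      _ = ENNReal.ofReal A := liminf_const _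

end Coupling

/-! ### The Gibbs variational principle -/

section Gibbs

open InformationTheory

variable {Z : Type*} [MeasurableSpace Z] {P Q : Measure Z}

theorem integrable_of_abs_le [IsFiniteMeasure Q] {g : Z → ℝ} (hg : Measurable g) {C : ℝ}
    (hC : ∀ x, |g x| ≤ C) : Integrable g Q :=
  Integrable.of_bound hg.aestronglyMeasurable C (Eventually.of_forall hC)

theorem integrable_exp_of_abs_le [IsFiniteMeasure Q] {g : Z → ℝ} (hg : Measurable g) {C : ℝ}
    (hC : ∀ x, |g x| ≤ C) : Integrable (fun x ↦ Real.exp (g x)) Q :=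
  integrable_of_abs_le hg.exp (C := Real.exp C) fun x ↦ by
    rw [Real.abs_exp, Real.exp_le_exp]
    exact (le_abs_self _).trans (hC x)

/-- The easy half of the Gibbs variational principle. -/
theorem integral_sub_toReal_klDiv_le_log_integral_exp [IsProbabilityMeasure P]
    [IsProbabilityMeasure Q] (hPQ : P ≪ Q) (hkl : klDiv P Q ≠ ∞) {g : Z → ℝ} (hg : Measurable g)
    {C : ℝ} (hC : ∀ x, |g x| ≤ C) :
    ∫ x, g x ∂P - (klDiv P Q).toReal ≤ Real.log (∫ x, Real.exp (g x) ∂Q) := by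
  have hexp := integrable_exp_of_abs_le (Q := Q) hg hC
  have hint := (klDiv_ne_top_iff.1 hkl).2
  have h1 := integral_llr_tilted_right hPQ (integrable_of_abs_le hg hC) hexp hint
  have := isProbabilityMeasure_tilted hexp
  -- The gap in the inequality is the relative entropy of P with respect to the tilted measure.
  have h2 : 0 ≤ ∫ x, llr P (Q.tilted g) x ∂P := by
    rw [← toReal_klDiv_of_measure_eq (hPQ.trans (absolutelyContinuous_tilted hexp)) (by simp)]
    exact ENNReal.toReal_nonneg
  rw [toReal_klDiv_of_measure_eq hPQ (by simp)]
  linarith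

/-- The log-density of the tilted measure is g - log Q(exp g), bounded because g is. -/
theorem klDiv_tilted_ne_top [IsProbabilityMeasure Q] {g : Z → ℝ} (hg : Measurable g) {C : ℝ}
    (hC : ∀ x, |g x| ≤ C) : klDiv (Q.tilted g) Q ≠ ∞ := by
  have hexp := integrable_exp_of_abs_le (Q := Q) hg hC
  have := isProbabilityMeasure_tilted hexp
  refine klDiv_ne_top (tilted_absolutelyContinuous Q g) ?_
  refine ((integrable_of_abs_le hg hC).sub (integrable_const
    (Real.log (∫ x, Real.exp (g x) ∂Q)))).congr ?_
  exact EventuallyEq.symm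
    ((tilted_absolutelyContinuous Q g).ae_le (log_rnDeriv_tilted_left_self hexp))

/-- The tilted measure attains the Gibbs variational principle. -/
theorem integral_tilted_sub_toReal_klDiv [IsProbabilityMeasure Q] {g : Z → ℝ} (hg : Measurable g)
    {C : ℝ} (hC : ∀ x, |g x| ≤ C) :
    ∫ x, g x ∂(Q.tilted g) - (klDiv (Q.tilted g) Q).toReal =
      Real.log (∫ x, Real.exp (g x) ∂Q) := by
  have hexp := integrable_exp_of_abs_le (Q := Q) hg hC
  have := isProbabilityMeasure_tilted hexp
  have hac := tilted_absolutelyContinuous Q g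
  rw [toReal_klDiv_of_measure_eq hac (by simp)]
  have h1 : ∫ x, llr (Q.tilted g) Q x ∂(Q.tilted g) =
      ∫ x, (g x - Real.log (∫ x, Real.exp (g x) ∂Q)) ∂(Q.tilted g) :=
    integral_congr_ae (hac.ae_le (log_rnDeriv_tilted_left_self hexp))
  rw [h1, integral_sub (integrable_of_abs_le hg hC) (integrable_const _)]
  simp

end Gibbs

/-! ### Dual form of the transport inequality -/

section TransportInequality

open InformationTheory

variable {Z : Type*} [MetricSpace Z]

/-- The cost `d(x, y) ^ p / p`. -/
noncomputable def powCost (Z : Type*) [MetricSpace Z] (p : ℝ) (x y : Z) : ℝ := dist x y ^ p / p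

theorem continuous_powCost {p : ℝ} (hp : 0 < p) :
    Continuous fun w : Z × Z ↦ powCost Z p w.1 w.2 :=
  (continuous_dist.rpow_const fun _ ↦ Or.inr hp.le).div_const p

theorem powCost_nonneg {p : ℝ} (hp : 0 < p) (x y : Z) : 0 ≤ powCost Z p x y :=
  div_nonneg (Real.rpow_nonneg dist_nonneg _) hp.le

theorem powCost_self {p : ℝ} (hp : 0 < p) (x : Z) : powCost Z p x x = 0 := by
  simp [powCost, hp.ne']

theorem ofReal_powCost {p : ℝ} (hp : 0 < p) (x y : Z) :
    ENNReal.ofReal p * ENNReal.ofReal (powCost Z p x y) = edist x y ^ p := by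
  rw [← ENNReal.ofReal_mul hp.le, powCost, mul_div_cancel₀ _ hp.ne', edist_dist,
    ENNReal.ofReal_rpow_of_nonneg dist_nonneg hp.le]

variable [MeasurableSpace Z] [BorelSpace Z]

/-- The exponential-moment form of a family of dual bounds. -/
theorem log_integral_exp_costTransform_le_iff {p : ℝ} (hp : 0 < p) (Q : Measure Z)
    [IsProbabilityMeasure Q] (f : Z →ᵇ ℝ) (t a : ℝ) :
    Real.log (∫ x, Real.exp (t * costTransform (powCost Z p) f x) ∂Q) ≤ a ↔
      ∀ P : Measure Z, IsProbabilityMeasure P → P ≪ Q → klDiv P Q ≠ ∞ →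
        t * ∫ x, costTransform (powCost Z p) f x ∂P - (klDiv P Q).toReal ≤ a := by
  have hg : Measurable fun x ↦ t * costTransform (powCost Z p) f x :=
    (measurable_costTransform (continuous_powCost hp) (powCost_nonneg hp) f).const_mul t
  have hC : ∀ x, |t * costTransform (powCost Z p) f x| ≤ |t| * ‖f‖ := fun x ↦ by
    rw [abs_mul]
    gcongr
    exact abs_costTransform_le (powCost_nonneg hp) (powCost_self hp) f x
  constructor
  · intro h P _ hPQ hkl
    have := integral_sub_toReal_klDiv_le_log_integral_exp hPQ hkl hg hC
    rw [integral_const_mul] at this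
    exact this.trans h
  · intro h
    have h1 := h _ (isProbabilityMeasure_tilted (integrable_exp_of_abs_le (Q := Q) hg hC))
      (tilted_absolutelyContinuous Q _) (klDiv_tilted_ne_top hg hC)
    rwa [← integral_const_mul, integral_tilted_sub_toReal_klDiv hg hC] at h1

variable [SecondCountableTopology Z]

theorem lintegral_edist_rpow {p : ℝ} (hp : 0 < p) (π : Measure (Z × Z)) :
    ∫⁻ w, edist w.1 w.2 ^ p ∂π =
      ENNReal.ofReal p * ∫⁻ w, ENNReal.ofReal (powCost Z p w.1 w.2) ∂π := by
  rw [← lintegral_const_mul _ (continuous_powCost hp).measurable.ennreal_ofReal]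
  simp_rw [ofReal_powCost hp]

/-- The inequality `T_p(1)` in dual form. -/
theorem satisfiesT_one_iff_integral_costTransform_le [LocallyCompactSpace Z] [SigmaCompactSpace Z]
    {p : ℝ} (hp : 0 < p) (Q : Measure Z) [IsProbabilityMeasure Q] :
    SatisfiesT p 1 Q ↔ ∀ P : Measure Z, IsProbabilityMeasure P → P ≪ Q → klDiv P Q ≠ ∞ →
      ∀ f : Z →ᵇ ℝ, ∫ x, costTransform (powCost Z p) f x ∂P ≤
        ∫ x, f x ∂Q + (2 * (klDiv P Q).toReal) ^ (p / 2) / p := by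
  -- The square root is rewritten as a 1/p-th power, to match the root in `transportCost`.
  have hRHS : ∀ P : Measure Z, klDiv P Q ≠ ∞ →
      (2 * ((1 : ℝ≥0) : ℝ≥0∞) * klDiv P Q) ^ (1 / 2 : ℝ) =
        ENNReal.ofReal ((2 * (klDiv P Q).toReal) ^ (p / 2)) ^ (1 / p) := fun P hkl ↦ by
    have h0 : (0 : ℝ) ≤ 2 * (klDiv P Q).toReal := by positivity
    rw [← ENNReal.ofReal_rpow_of_nonneg h0 (by positivity), ← ENNReal.rpow_mul,
      ENNReal.ofReal_mul zero_le_two, ENNReal.ofReal_toReal hkl]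
    congr 1
    · simp
    · field_simp
  have hroot : (0 : ℝ) < 1 / p := one_div_pos.2 hp
  constructor
  · intro hT P _ hPQ hkl f
    have h1 := hT P inferInstance hPQ
    rw [hRHS P hkl] at h1
    set m := ∫ x, costTransform (powCost Z p) f x ∂P - ∫ x, f x ∂Q
    have h2 : ENNReal.ofReal (p * m) ^ (1 / p) ≤ transportCost p P Q := by
      refine le_iInf₂ fun π hπ ↦ ENNReal.rpow_le_rpow ?_ hroot.le
      rw [lintegral_edist_rpow hp, ENNReal.ofReal_mul hp.le]
      gcongr
      exact hπ.ofReal_integral_costTransform_sub_le (continuous_powCost hp) (powCost_nonneg hp)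
        (powCost_self hp) f
    have h3 := (ENNReal.rpow_le_rpow_iff hroot).1 (h2.trans h1)
    rw [ENNReal.ofReal_le_ofReal_iff (by positivity)] at h3
    have h4 : m ≤ (2 * (klDiv P Q).toReal) ^ (p / 2) / p := by
      rw [le_div_iff₀ hp]
      linarith
    linarith
  · intro h P _ hPQ
    by_cases hkl : klDiv P Q = ∞
    · simp [hkl]
    obtain ⟨π, hπ, hle⟩ := exists_isCoupling_of_dual_bound P Q (continuous_powCost hp)
      (powCost_nonneg hp) (powCost_self hp) (h P inferInstance hPQ hkl)
    refine (iInf₂_le π hπ).trans ?_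
    rw [hRHS P hkl]
    refine ENNReal.rpow_le_rpow ?_ hroot.le
    rw [lintegral_edist_rpow hp]
    refine (mul_le_mul_right hle _).trans_eq ?_
    rw [← ENNReal.ofReal_mul hp.le, mul_div_cancel₀ _ hp.ne']

end TransportInequality

/-! ### Linearising the entropy bound -/

section Young

/-- Young's inequality with exponents `2 / (2 - p)` and `2 / p`. -/
theorem mul_rpow_div_sub_le {p t D : ℝ} (hp : 0 < p) (hp2 : p < 2) (ht : 0 ≤ t) (hD : 0 ≤ D) :
    t * ((2 * D) ^ (p / 2) / p) - D ≤ (1 / p - 1 / 2) * t ^ (2 / (2 - p)) := by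
  have hq : 0 < 2 - p := by linarith
  have h := Real.geom_mean_le_arith_mean2_weighted (w₁ := (2 - p) / 2) (w₂ := p / 2)
    (p₁ := t ^ (2 / (2 - p))) (p₂ := 2 * D) (by positivity) (by positivity) (by positivity)
    (by positivity) (by ring)
  rw [← Real.rpow_mul ht, show 2 / (2 - p) * ((2 - p) / 2) = 1 by field_simp, Real.rpow_one] at h
  have h2 := div_le_div_of_nonneg_right h hp.le
  have e1 : t * (2 * D) ^ (p / 2) / p = t * ((2 * D) ^ (p / 2) / p) := by ring
  have e2 : ((2 - p) / 2 * t ^ (2 / (2 - p)) + p / 2 * (2 * D)) / p =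
      (1 / p - 1 / 2) * t ^ (2 / (2 - p)) + D := by
    field_simp
  linarith

/-- The equality case of `mul_rpow_div_sub_le`. -/
theorem exists_mul_rpow_div_sub_eq {p D : ℝ} (hp : 0 < p) (hp2 : p < 2) (hD : 0 < D) :
    ∃ t : ℝ, 0 < t ∧
      t * ((2 * D) ^ (p / 2) / p) - D = (1 / p - 1 / 2) * t ^ (2 / (2 - p)) := by
  have hq : 0 < 2 - p := by linarith
  have h2D : 0 < 2 * D := by positivity
  -- Equality in the weighted mean inequality requires t^(2/(2-p)) = 2D.
  refine ⟨(2 * D) ^ ((2 - p) / 2), by positivity, ?_⟩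
  rw [← Real.rpow_mul h2D.le, show (2 - p) / 2 * (2 / (2 - p)) = 1 by field_simp, Real.rpow_one,
    ← mul_div_assoc, ← Real.rpow_add h2D, show (2 - p) / 2 + p / 2 = 1 by ring, Real.rpow_one]
  field_simp

end Young

/-! ### The two equivalences -/

theorem corollary1 {Z : Type*} [MetricSpace Z] [PolishSpace Z] [LocallyCompactSpace Z]
    [SigmaCompactSpace Z] [MeasurableSpace Z] [BorelSpace Z]
    (Q : Measure Z) [IsProbabilityMeasure Q] :
    (SatisfiesT 2 1 Q ↔
      ∀ f : Z →ᵇ ℝ,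
        Real.log (∫ x, Real.exp (⨅ z : Z, (f z + dist x z ^ 2 / 2)) ∂Q) ≤ ∫ x, f x ∂Q) ∧
    (∀ p : ℝ, 1 ≤ p → p < 2 →
      (SatisfiesT p 1 Q ↔
        ∀ t : ℝ, 0 ≤ t → ∀ f : Z →ᵇ ℝ,
          Real.log (∫ x, Real.exp (t * ⨅ z : Z, (f z + dist x z ^ p / p)) ∂Q) ≤
            (1 / p - 1 / 2) * t ^ (2 / (2 - p)) + t * ∫ x, f x ∂Q)) := by
  refine ⟨?_, fun p hp1 hp2 ↦ ?_⟩
  · have hcost : ∀ (f : Z →ᵇ ℝ) x, (⨅ z : Z, (f z + dist x z ^ 2 / 2)) =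
        1 * costTransform (powCost Z 2) f x := fun f x ↦ by
      simp only [one_mul, costTransform, powCost, Real.rpow_two]
    simp_rw [hcost, satisfiesT_one_iff_integral_costTransform_le two_pos Q,
      log_integral_exp_costTransform_le_iff two_pos Q]
    have hpow : ∀ D : ℝ, (2 * D) ^ ((2 : ℝ) / 2) / 2 = D := fun D ↦ by simp
    simp_rw [hpow, one_mul, sub_le_iff_le_add]
    exact ⟨fun h f P hP hPQ hkl ↦ h P hP hPQ hkl f, fun h P hP hPQ hkl f ↦ h f P hP hPQ hkl⟩
  · have hp : 0 < p := by linarith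
    change _ ↔ ∀ t : ℝ, 0 ≤ t → ∀ f : Z →ᵇ ℝ,
      Real.log (∫ x, Real.exp (t * costTransform (powCost Z p) f x) ∂Q) ≤ _
    simp_rw [satisfiesT_one_iff_integral_costTransform_le hp Q,
      log_integral_exp_costTransform_le_iff hp Q]
    constructor
    · intro h t ht f P hP hPQ hkl
      have h1 := mul_le_mul_of_nonneg_left (h P hP hPQ hkl f) ht
      have h2 := mul_rpow_div_sub_le hp hp2 ht
        (ENNReal.toReal_nonneg (a := InformationTheory.klDiv P Q))
      linarith
    · intro h P hP hPQ hkl f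
      -- At D = 0 the optimal t would be 0, which carries no information; but then P = Q, and f^c ≤
      -- f suffices.
      rcases (ENNReal.toReal_nonneg (a := InformationTheory.klDiv P Q)).eq_or_lt with hD | hD
      · have h0 : InformationTheory.klDiv P Q = 0 :=
          ((ENNReal.toReal_eq_zero_iff _).1 hD.symm).resolve_right hkl
        obtain rfl := InformationTheory.klDiv_eq_zero_iff.1 h0
        have h1 : ∫ x, costTransform (powCost Z p) f x ∂P ≤ ∫ x, f x ∂P :=
          integral_mono (integrable_costTransform (continuous_powCost hp) (powCost_nonneg hp)
            (powCost_self hp) f P) (f.integrable P) fun x ↦ by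
              simpa [powCost_self hp] using costTransform_le (powCost_nonneg hp) f x x
        exact h1.trans (le_add_of_nonneg_right (by positivity))
      · obtain ⟨t, ht, hteq⟩ := exists_mul_rpow_div_sub_eq hp hp2 hD
        refine le_of_mul_le_mul_left ?_ ht
        have := h t ht.le f P hP hPQ hkl
        linarith
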